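/- Let $G=(A,B,E)$ be a finite simple bipartite graph with nonempty color classes $A$ and $B$ and at least $4$ vertices. Here $N(X)$ is the set of vertices adjacent to some vertex of $X$; a stable set is a set of pairwise nonadjacent vertices; $\alpha(H)$ is the maximum size of a stable set of $H$; a graph $H$ is $\alpha^{+}$-stable if $\alpha(H+e)=\alpha(H)$ for every edge $e$ of the complement of $H$; and $G$ is balanced if $|A|=|B|$. The following assertions are equivalent: (i) $G$ is cover-irreducible, i.e. $G$ is balanced and its minimum vertex covers are exactly $A$ and $B$; (ii) $G$ is bistable, i.e. the maximum stable sets of $G$ are exactly $A$ and $B$; (iii) $|N(X)|>|X|$ for every nonempty proper subset $X$ of $A$ and for every nonempty proper subset $X$ of $B$; (iv) $G$ is balanced and $|N(X)|>|X|$ for every nonempty proper subset $X$ of $A$; (v) $G-a-b$ is $\alpha^{+}$-stable for all $a\in A$ and $b\in B$; (vi) $G-a-b$ has a perfect matching for all $a\in A$ and $b\in B$; (vii) $G$ is connected and every edge of $G$ lies in some perfect matching of $G$; (viii) $G$ is elementary, i.e. the union of all perfect matchings of $G$ is a (nonempty) connected subgraph of $G$; (ix) $G=G_0\cup H_1\cup\dots\cup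 H_k$ for some $k\ge 0$, where $G_0$ consists of two vertices and an edge joining them, and each $H_i$ is a path with an even number of vertices (possibly a single edge) that joins two vertices of $G_0\cup H_1\cup\dots\cup H_{i-1}$ in different color classes and has no other vertex in common with $G_0\cup H_1\cup\dots\cup H_{i-1}$. -/

import Mathlib

namespace BistableGraph

/-- `A`, `B` are the two color classes of the bipartite graph `G`: they are disjoint and nonempty,
they cover the vertex set, and every edge joins a vertex of `A` to a vertex of `B`. -/
structure IsBipartition {V : Type*} [Fintype V] [DecidableEq V]
    (G : SimpleGraph V) (A B : Finset V) : Prop where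
  isBipartiteWith : G.IsBipartiteWith (A : Set V) (B : Set V)
  union_eq : A ∪ B = Finset.univ
  left_nonempty : A.Nonempty
  right_nonempty : B.Nonempty

/-- A vertex cover of minimum cardinality. -/
structure IsMinVertexCover {V : Type*} (G : SimpleGraph V) (C : Finset V) : Prop where
  isVertexCover : G.IsVertexCover (C : Set V)
  minimum : ∀ D : Finset V, G.IsVertexCover (D : Set V) → C.card ≤ D.card

/-- Cover-irreducible: balanced, and the minimum vertex covers are exactly `A` and `B`. -/
def IsCoverIrreducible {V : Type*} (G : SimpleGraph V) (A B : Finset V) : Prop :=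
  A.card = B.card ∧ ∀ C : Finset V, IsMinVertexCover G C ↔ C = A ∨ C = B

/-- Bistable: the maximum stable sets are exactly `A` and `B`. -/
def IsBistable {V : Type*} [Finite V] (G : SimpleGraph V) (A B : Finset V) : Prop :=
  ∀ S : Finset V, G.IsMaximumIndepSet S ↔ S = A ∨ S = B

/-- The neighborhood `N(X)`, the union of the neighborhoods of the elements of `X`. -/
def nbhd {V : Type*} (G : SimpleGraph V) (X : Finset V) : Set V :=
  ⋃ x ∈ X, G.neighborSet x

/-- Every nonempty proper subset `X` of `A` satisfies `|N(X)| > |X|`. -/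
def HasSurplus {V : Type*} (G : SimpleGraph V) (A : Finset V) : Prop :=
  ∀ X : Finset V, X.Nonempty → X ⊂ A → X.card < (nbhd G X).ncard

/-- Adding any edge of the complement does not change the stability number. -/
def IsAlphaPlusStable {V : Type*} (G : SimpleGraph V) : Prop :=
  ∀ u v : V, Gᶜ.Adj u v → (G ⊔ SimpleGraph.edge u v).indepNum = G.indepNum

/-- The graph `G - a - b`. -/
def deletePair {V : Type*} (G : SimpleGraph V) (a b : V) :
    SimpleGraph ({a, b}ᶜ : Set V) :=
  G.induce ({a, b}ᶜ : Set V)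

/-- `G` has a perfect matching. -/
def HasPerfectMatching {V : Type*} (G : SimpleGraph V) : Prop :=
  ∃ M : G.Subgraph, M.IsPerfectMatching

/-- Every edge of `G` lies in some perfect matching of `G`. -/
def EveryEdgeMatched {V : Type*} (G : SimpleGraph V) : Prop :=
  ∀ u v : V, G.Adj u v → ∃ M : G.Subgraph, M.IsPerfectMatching ∧ M.Adj u v

/-- Elementary: the union of all perfect matchings is a connected subgraph
(connected subgraphs are nonempty, so a perfect matching has to exist). -/
def IsElementary {V : Type*} (G : SimpleGraph V) : Prop :=
  (sSup {M : G.Subgraph | M.IsPerfectMatching}).Connected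

/-- The walk `p` from `u` to `v` is an ear over the subgraph `H`: an even path, that is, a path on
an even number of vertices, whose ends `u` and `v` are vertices of `H` in different color classes
(it is read from its end in `A` to its end in `B`) and which has no other vertex in common
with `H`. A single edge is such a path, on two vertices. -/
structure IsEar {V : Type*} {G : SimpleGraph V} (A B : Finset V) (H : G.Subgraph)
    {u v : V} (p : G.Walk u v) : Prop where
  isPath : p.IsPath
  even : Even p.support.length
  start_mem_class : u ∈ A
  end_mem_class : v ∈ B
  start_mem : u ∈ H.verts
  end_mem : v ∈ H.verts
  inter : ∀ w ∈ p.support, w ∈ H.verts → w = u ∨ w = v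

/-- The subgraphs of `G` of the form `G₀ ∪ H₁ ∪ ⋯ ∪ Hₖ` (`k ≥ 0`), where `G₀` is an edge with its
two ends and each `Hᵢ` is an ear over `G₀ ∪ H₁ ∪ ⋯ ∪ Hᵢ₋₁`. -/
inductive EarBuilt {V : Type*} {G : SimpleGraph V} (A B : Finset V) : G.Subgraph → Prop
  | base {u v : V} (h : G.Adj u v) : EarBuilt A B (G.subgraphOfAdj h)
  | addEar {H : G.Subgraph} {u v : V} (p : G.Walk u v) (hH : EarBuilt A B H)
      (hp : IsEar A B H p) : EarBuilt A B (H ⊔ p.toSubgraph)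

/-- `G` itself is of the form `G₀ ∪ H₁ ∪ ⋯ ∪ Hₖ`. -/
def HasEarDecomposition {V : Type*} (G : SimpleGraph V) (A B : Finset V) : Prop :=
  EarBuilt A B (⊤ : G.Subgraph)

end BistableGraph

/-!
A stable set `S` with `S ∩ A = X` has at most `|X| + |B| - |N(X)|` elements, and this bound is
attained. So stable sets larger than `B` correspond to violations of Hall's condition, and, when
`|A| = |B|`, maximum stable sets other than `A` and `B` to proper subsets of `A` without surplus.

Adding the edge `uv` lowers the stability number exactly when `u` and `v` both lie in the core, the
intersection of all maximum stable sets. In a bipartite graph the maximum stable sets are closed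
under `(S, T) ↦ (S ∩ T ∩ A) ∪ ((S ∪ T) ∩ B)`, so some maximum stable set meets `A` only in the core;
this turns α⁺-stability of a balanced graph into Hall's condition.

If `G` has surplus, then a subgraph closed under the partners of a fixed perfect matching grows by
ears: leave it along any edge and follow an alternating path until it returns. Conversely, a stable
set contains at most half of the new vertices of an ear, so adding an ear preserves the property of
having only the two color classes as maximum stable sets.
-/

namespace BistableGraph

open SimpleGraph Finset

variable {V : Type*} {G : SimpleGraph V} {A B S T X Y : Finset V} {a b u v : V}

/-- `A` and `B` are complementary stable sets of `G`. Unlike in `IsBipartition` they may be empty,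
so that the notion passes from `G` to `G - a - b`. -/
structure IsBicoloring (G : SimpleGraph V) (A B : Finset V) : Prop where
  isBipartiteWith : G.IsBipartiteWith (A : Set V) (B : Set V)
  mem_or_mem : ∀ v, v ∈ A ∨ v ∈ B

lemma IsBipartition.isBicoloring [Fintype V] [DecidableEq V] (h : IsBipartition G A B) :
    IsBicoloring G A B where
  isBipartiteWith := h.isBipartiteWith
  mem_or_mem v := by simpa [← h.union_eq] using mem_univ v

namespace IsBicoloring

lemma symm (h : IsBicoloring G A B) : IsBicoloring G B A where
  isBipartiteWith := h.isBipartiteWith.symm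
  mem_or_mem v := (h.mem_or_mem v).symm

lemma disjoint (h : IsBicoloring G A B) : Disjoint A B :=
  disjoint_coe.1 h.isBipartiteWith.disjoint

lemma notMem_right_iff (h : IsBicoloring G A B) : v ∉ B ↔ v ∈ A :=
  ⟨(h.mem_or_mem v).resolve_right, fun hA hB ↦ disjoint_left.1 h.disjoint hA hB⟩

lemma notMem_left_iff (h : IsBicoloring G A B) : v ∉ A ↔ v ∈ B :=
  h.symm.notMem_right_iff

lemma mem_right_of_adj (h : IsBicoloring G A B) (hu : u ∈ A) (huv : G.Adj u v) : v ∈ B :=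
  h.isBipartiteWith.mem_of_mem_adj hu huv

lemma mem_left_of_adj (h : IsBicoloring G A B) (hu : u ∈ B) (huv : G.Adj u v) : v ∈ A :=
  h.symm.mem_right_of_adj hu huv

lemma isIndepSet_left (h : IsBicoloring G A B) : G.IsIndepSet (A : Set V) :=
  fun _ hu _ hv _ huv ↦ disjoint_left.1 h.disjoint hv (h.mem_right_of_adj hu huv)

lemma isIndepSet_right (h : IsBicoloring G A B) : G.IsIndepSet (B : Set V) :=
  h.symm.isIndepSet_left

lemma isIndepSet_iff (h : IsBicoloring G A B) :
    G.IsIndepSet (S : Set V) ↔ ∀ u ∈ S, u ∈ A → ∀ v ∈ S, v ∈ B → ¬ G.Adj u v := by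
  refine ⟨fun hS u hu _ v hv _ huv ↦ hS hu hv huv.ne huv, fun hS u hu v hv _ huv ↦ ?_⟩
  rcases h.mem_or_mem u with huA | huB
  · exact hS u hu huA v hv (h.mem_right_of_adj huA huv) huv
  · exact hS v hv (h.mem_left_of_adj huB huv) u hu huB huv.symm

lemma card_inter_add_card_inter [DecidableEq V] (h : IsBicoloring G A B) (S : Finset V) :
    #(S ∩ A) + #(S ∩ B) = #S := by
  rw [← card_union_of_disjoint (h.disjoint.mono inter_subset_right inter_subset_right),
    ← inter_union_distrib_left, inter_eq_left.2 fun v _ ↦ mem_union.2 (h.mem_or_mem v)]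

lemma compl_left [Fintype V] [DecidableEq V] (h : IsBicoloring G A B) : Aᶜ = B := by
  ext v
  rw [mem_compl, h.notMem_left_iff]

end IsBicoloring

section Neighborhood

lemma mem_nbhd : v ∈ nbhd G X ↔ ∃ x ∈ X, G.Adj x v := by
  simp [nbhd]

lemma nbhd_mono (h : X ⊆ Y) : nbhd G X ⊆ nbhd G Y := fun _ hv ↦
  let ⟨x, hx, hxv⟩ := mem_nbhd.1 hv
  mem_nbhd.2 ⟨x, h hx, hxv⟩

lemma IsBicoloring.nbhd_subset (h : IsBicoloring G A B) (hX : X ⊆ A) : nbhd G X ⊆ B := fun _ hv ↦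
  let ⟨_, hx, hxv⟩ := mem_nbhd.1 hv
  h.mem_right_of_adj (hX hx) hxv

lemma IsBicoloring.card_add_ncard_nbhd_le [DecidableEq V] (h : IsBicoloring G A B)
    (hS : G.IsIndepSet (S : Set V)) : #S + (nbhd G (S ∩ A)).ncard ≤ #(S ∩ A) + #B := by
  have hdisj : Disjoint (nbhd G (S ∩ A)) (S ∩ B : Finset V) :=
    Set.disjoint_left.2 fun v hv hvS ↦
      let ⟨_, hx, hxv⟩ := mem_nbhd.1 hv
      hS (mem_inter.1 hx).1 (mem_inter.1 hvS).1 hxv.ne hxv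
  have hsub := h.nbhd_subset (inter_subset_right : S ∩ A ⊆ A)
  have hle : (nbhd G (S ∩ A)).ncard + #(S ∩ B) ≤ #B := by
    rw [← Set.ncard_coe_finset (S ∩ B), ← Set.ncard_coe_finset B,
      ← Set.ncard_union_eq hdisj (B.finite_toSet.subset hsub) (finite_toSet _)]
    exact Set.ncard_le_ncard (Set.union_subset hsub (coe_subset.2 inter_subset_right))
      B.finite_toSet
  have := h.card_inter_add_card_inter S
  lia

lemma IsBicoloring.exists_isIndepSet_inter_eq [DecidableEq V] (h : IsBicoloring G A B)
    (hX : X ⊆ A) :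
    ∃ T : Finset V, G.IsIndepSet (T : Set V) ∧ T ∩ A = X ∧ #T + (nbhd G X).ncard = #X + #B := by
  classical
  set R := {b ∈ B | b ∉ nbhd G X}
  have hRB : R ⊆ B := filter_subset _ _
  have hXR : ∀ x ∈ X, ∀ r ∈ R, ¬ G.Adj x r := fun x hx r hr hxr ↦
    (mem_filter.1 hr).2 (mem_nbhd.2 ⟨x, hx, hxr⟩)
  have hRN : #R + (nbhd G X).ncard = #B := by
    rw [← Set.ncard_coe_finset R, ← Set.ncard_coe_finset B,
      ← Set.ncard_sdiff_add_ncard_of_subset (h.nbhd_subset hX) B.finite_toSet]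
    congr 2
    ext v
    simp [R]
  refine ⟨X ∪ R, ?_, ?_, ?_⟩
  · refine h.isIndepSet_iff.2 fun u hu huA v hv hvB ↦ hXR u ?_ v ?_
    · exact (mem_union.1 hu).resolve_right fun huR ↦ h.notMem_right_iff.2 huA (hRB huR)
    · exact (mem_union.1 hv).resolve_left fun hvX ↦ h.notMem_left_iff.2 hvB (hX hvX)
  · rw [union_inter_distrib_right, inter_eq_left.2 hX,
      disjoint_iff_inter_eq_empty.1 (h.disjoint.symm.mono_left hRB), union_empty]
  · rw [card_union_of_disjoint (h.disjoint.mono hX hRB), add_assoc, hRN]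

end Neighborhood

section Hall

/-- Hall's condition for a matching of `G` that covers `A`. -/
def HallCondition (G : SimpleGraph V) (A : Finset V) : Prop :=
  ∀ X ⊆ A, #X ≤ (nbhd G X).ncard

lemma HallCondition.card_le_card (hA : HallCondition G A) (h : IsBicoloring G A B) : #A ≤ #B :=
  (hA A Subset.rfl).trans <| by
    simpa using Set.ncard_le_ncard (h.nbhd_subset Subset.rfl) B.finite_toSet

lemma IsBicoloring.hallCondition_iff (h : IsBicoloring G A B) :
    HallCondition G A ↔ ∀ S : Finset V, G.IsIndepSet (S : Set V) → #S ≤ #B := by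
  classical
  refine ⟨fun hA S hS ↦ ?_, fun hB X hX ↦ ?_⟩
  · have := h.card_add_ncard_nbhd_le hS
    have := hA (S ∩ A) inter_subset_right
    lia
  · obtain ⟨T, hT, -, hTX⟩ := h.exists_isIndepSet_inter_eq hX
    have := hB T hT
    lia

lemma HasSurplus.hallCondition [Finite V] (hA : HasSurplus G A) (h2 : 2 ≤ #A) :
    HallCondition G A := by
  classical
  intro X hX
  obtain rfl | hXne := X.eq_empty_or_nonempty
  · simp
  obtain rfl | hXA := eq_or_ssubset_of_subset hX
  · obtain ⟨x, hx⟩ := hXne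
    have hlt := hA (X.erase x) (card_pos.1 (by rw [card_erase_of_mem hx]; lia))
      (erase_ssubset hx)
    have hle := Set.ncard_le_ncard (nbhd_mono (G := G) (X.erase_subset x)) (Set.toFinite _)
    rw [card_erase_of_mem hx] at hlt
    lia
  · exact (hA X hXne hXA).le

lemma HasSurplus.card_le_card [Finite V] (hA : HasSurplus G A) (h : IsBicoloring G A B)
    (hV : 2 ≤ #A + #B) : #A ≤ #B := by
  by_contra! hlt
  exact hlt.not_ge ((hA.hallCondition (by lia)).card_le_card h)

/-- `m` sends each vertex of `G` to its partner in a perfect matching of `G`. -/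
structure IsMate (G : SimpleGraph V) (m : V → V) : Prop where
  adj : ∀ v, G.Adj v (m v)
  involutive : Function.Involutive m

lemma exists_isMate_of_isPerfectMatching {M : G.Subgraph} (hM : M.IsPerfectMatching) :
    ∃ m, IsMate G m ∧ ∀ u v, M.Adj u v ↔ m u = v := by
  choose m hm huniq using Subgraph.isPerfectMatching_iff.1 hM
  have hMm : ∀ u v, M.Adj u v ↔ m u = v := fun u v ↦
    ⟨fun huv ↦ (huniq u v huv).symm, fun huv ↦ huv ▸ hm u⟩
  exact ⟨m, ⟨fun v ↦ (hm v).adj_sub, fun v ↦ (hMm _ _).1 (hm v).symm⟩, hMm⟩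

lemma HasPerfectMatching.exists_isMate (hG : HasPerfectMatching G) : ∃ m, IsMate G m :=
  let ⟨_, hM⟩ := hG
  let ⟨m, hm, _⟩ := exists_isMate_of_isPerfectMatching hM
  ⟨m, hm⟩

lemma IsMate.hallCondition [Finite V] {m : V → V} (hm : IsMate G m) (A : Finset V) :
    HallCondition G A := fun X _ ↦ by
  rw [← Set.ncard_coe_finset X]
  exact Set.ncard_le_ncard_of_injOn m (fun x hx ↦ mem_nbhd.2 ⟨x, hx, hm.adj x⟩)
    hm.involutive.injective.injOn (Set.toFinite _)

lemma IsMate.card_eq [Finite V] {m : V → V} (hm : IsMate G m) (h : IsBicoloring G A B) :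
    #A = #B :=
  ((hm.hallCondition A).card_le_card h).antisymm ((hm.hallCondition B).card_le_card h.symm)

lemma HallCondition.hasPerfectMatching [Finite V] (hA : HallCondition G A)
    (h : IsBicoloring G A B) (hAB : #A = #B) : HasPerfectMatching G := by
  classical
  have := Fintype.ofFinite V
  obtain ⟨M, hAM, hM⟩ := exists_isMatching_of_forall_ncard_le h.isBipartiteWith fun s hs ↦ by
    lift s to Finset V using Set.toFinite s
    simpa [nbhd] using hA s (coe_subset.1 hs)
  have hpartner : ∀ x : A, ∃ y : B, M.Adj x y := fun x ↦
    let ⟨y, hxy, _⟩ := hM (hAM x.2)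
    ⟨⟨y, h.mem_right_of_adj x.2 hxy.adj_sub⟩, hxy⟩
  choose f hf using hpartner
  have hinj : Function.Injective f := fun x y hxy ↦
    Subtype.ext (hM.eq_of_adj_right (hf x) (hxy ▸ hf y))
  have hsurj := hinj.surjective_of_finite (equivOfCardEq hAB)
  refine ⟨M, hM, fun v ↦ (h.mem_or_mem v).elim (fun hv ↦ hAM hv) fun hv ↦ ?_⟩
  obtain ⟨x, hx⟩ := hsurj ⟨v, hv⟩
  have := (hf x).snd_mem
  rwa [hx] at this

lemma IsBicoloring.hasPerfectMatching_iff [Finite V] (h : IsBicoloring G A B) :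
    HasPerfectMatching G ↔ #A = #B ∧ HallCondition G A := by
  refine ⟨fun hG ↦ ?_, fun ⟨hAB, hA⟩ ↦ hA.hasPerfectMatching h hAB⟩
  obtain ⟨m, hm⟩ := hG.exists_isMate
  exact ⟨hm.card_eq h, hm.hallCondition A⟩

lemma HasSurplus.exists_isMate [Finite V] (hA : HasSurplus G A) (h : IsBicoloring G A B)
    (hAB : #A = #B) (h2 : 2 ≤ #A) : ∃ m, IsMate G m :=
  ((hA.hallCondition h2).hasPerfectMatching h hAB).exists_isMate

end Hall

section Bistable

lemma isMinVertexCover_iff [Fintype V] [DecidableEq V] {C : Finset V} :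
    IsMinVertexCover G C ↔ G.IsMaximumIndepSet Cᶜ := by
  have hindep : ∀ D : Finset V, G.IsVertexCover (D : Set V) ↔ G.IsIndepSet (Dᶜ : Finset V) :=
    fun D ↦ by rw [coe_compl, isIndepSet_compl_iff_isVertexCover]
  have hcard : ∀ C D : Finset V, #C ≤ #D ↔ #Dᶜ ≤ #Cᶜ := fun C D ↦ by
    have := card_add_card_compl C
    have := card_add_card_compl D
    lia
  refine ⟨fun hC ↦ ⟨(hindep C).1 hC.isVertexCover, fun T hT ↦ ?_⟩,
    fun hC ↦ ⟨(hindep C).2 hC.isIndepSet, fun D hD ↦ ?_⟩⟩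
  · have := hC.minimum Tᶜ ((hindep _).2 (by rwa [compl_compl]))
    rwa [hcard, compl_compl] at this
  · exact (hcard C D).2 (hC.maximum _ ((hindep D).1 hD))

lemma IsBistable.card_eq [Finite V] (hG : IsBistable G A B) : #A = #B := by
  have hA := (hG A).2 (.inl rfl)
  have hB := (hG B).2 (.inr rfl)
  exact (hB.maximum _ hA.isIndepSet).antisymm (hA.maximum _ hB.isIndepSet)

lemma IsBistable.symm [Finite V] (hG : IsBistable G A B) : IsBistable G B A := fun S ↦ by
  rw [hG S, or_comm]

lemma IsBicoloring.isCoverIrreducible_iff [Finite V] (h : IsBicoloring G A B) :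
    IsCoverIrreducible G A B ↔ IsBistable G A B := by
  classical
  have := Fintype.ofFinite V
  have hcompl : ∀ C : Finset V, (Cᶜ = A ∨ Cᶜ = B) ↔ (C = A ∨ C = B) := fun C ↦ by
    rw [compl_eq_comm, compl_eq_comm (x := C) (y := B), h.compl_left, h.symm.compl_left, or_comm,
      eq_comm, @eq_comm _ B C]
  constructor
  · rintro ⟨-, hG⟩ S
    rw [← hcompl, ← hG, isMinVertexCover_iff, compl_compl]
  · refine fun hG ↦ ⟨hG.card_eq, fun C ↦ ?_⟩
    rw [isMinVertexCover_iff, hG, hcompl]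

lemma IsBistable.hasSurplus [Finite V] (hG : IsBistable G A B) (h : IsBicoloring G A B) :
    HasSurplus G A := by
  classical
  intro X hX hXA
  by_contra! hle
  obtain ⟨T, hT, hTX, hcard⟩ := h.exists_isIndepSet_inter_eq hXA.subset
  have hB := (hG B).2 (.inr rfl)
  have hTmax : G.IsMaximumIndepSet T := ⟨hT, fun U hU ↦ (hB.maximum U hU).trans (by lia)⟩
  rcases (hG T).1 hTmax with rfl | rfl
  · exact hXA.ne (by rw [← hTX, inter_self])
  · exact hX.ne_empty (by rw [← hTX, disjoint_iff_inter_eq_empty.1 h.disjoint.symm])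

lemma IsBicoloring.isBistable [Finite V] (h : IsBicoloring G A B) (hAB : #A = #B)
    (hS : ∀ S : Finset V, G.IsIndepSet (S : Set V) → #A ≤ #S → S = A ∨ S = B) :
    IsBistable G A B := by
  have hle : ∀ S : Finset V, G.IsIndepSet (S : Set V) → #S ≤ #A := fun S hS' ↦ by
    by_contra! hlt
    rcases hS S hS' hlt.le with rfl | rfl <;> lia
  refine fun S ↦ ⟨fun hmax ↦ hS S hmax.isIndepSet (hmax.maximum A h.isIndepSet_left), ?_⟩
  rintro (rfl | rfl)
  · exact ⟨h.isIndepSet_left, hle⟩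
  · exact ⟨h.isIndepSet_right, hAB ▸ hle⟩

lemma HasSurplus.isBistable [Finite V] (hA : HasSurplus G A) (h : IsBicoloring G A B)
    (hAB : #A = #B) (h2 : 2 ≤ #A) : IsBistable G A B := by
  classical
  refine h.isBistable hAB fun S hS hAS ↦ ?_
  have hSB := h.hallCondition_iff.1 (hA.hallCondition h2) S hS
  have htight : (nbhd G (S ∩ A)).ncard ≤ #(S ∩ A) := by
    have := h.card_add_ncard_nbhd_le hS
    lia
  obtain hempty | hne := (S ∩ A).eq_empty_or_nonempty
  · refine .inr (eq_of_subset_of_card_le (fun v hv ↦ h.notMem_left_iff.1 fun hvA ↦ ?_) (by lia))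
    exact notMem_empty v (hempty ▸ mem_inter.2 ⟨hv, hvA⟩)
  · have hSA : S ∩ A = A := by
      by_contra hne'
      exact htight.not_gt (hA _ hne (inter_subset_right.ssubset_of_ne hne'))
    exact .inl (eq_of_subset_of_card_le (inter_eq_right.1 hSA) (by lia)).symm

end Bistable

section Core

/-- The core of `G`, the intersection of its maximum stable sets. -/
def core [Finite V] (G : SimpleGraph V) : Set V :=
  {v | ∀ S : Finset V, G.IsMaximumIndepSet S → v ∈ S}

lemma isIndepSet_sup_edge_iff {S : Set V} (huv : u ≠ v) :
    (G ⊔ edge u v).IsIndepSet S ↔ G.IsIndepSet S ∧ ¬ (u ∈ S ∧ v ∈ S) := by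
  refine ⟨fun hS ↦ ⟨fun x hx y hy hxy hadj ↦ hS hx hy hxy (.inl hadj), fun ⟨hu, hv⟩ ↦
    hS hu hv huv (.inr ((edge_adj ..).2 ⟨.inl ⟨rfl, rfl⟩, huv⟩))⟩, ?_⟩
  rintro ⟨hS, hS'⟩ x hx y hy hxy (hadj | hadj)
  · exact hS hx hy hxy hadj
  · rcases ((edge_adj ..).1 hadj).1 with ⟨rfl, rfl⟩ | ⟨rfl, rfl⟩
    · exact hS' ⟨hx, hy⟩
    · exact hS' ⟨hy, hx⟩

lemma indepNum_sup_edge_eq_iff [Finite V] (huv : u ≠ v) :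
    (G ⊔ edge u v).indepNum = G.indepNum ↔ ¬ (u ∈ core G ∧ v ∈ core G) := by
  have hle : (G ⊔ edge u v).indepNum ≤ G.indepNum := by
    obtain ⟨S, hS⟩ := (G ⊔ edge u v).exists_isNIndepSet_indepNum
    rw [← hS.card_eq]
    exact ((isIndepSet_sup_edge_iff huv).1 hS.isIndepSet).1.card_le_indepNum
  refine ⟨fun heq ⟨hu, hv⟩ ↦ ?_, fun hcore ↦ hle.antisymm ?_⟩
  · obtain ⟨S, hS⟩ := (G ⊔ edge u v).exists_isNIndepSet_indepNum
    obtain ⟨hSG, huvS⟩ := (isIndepSet_sup_edge_iff huv).1 hS.isIndepSet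
    have hmax : G.IsMaximumIndepSet S :=
      ⟨hSG, fun T hT ↦ by rw [hS.card_eq, heq]; exact hT.card_le_indepNum⟩
    exact huvS ⟨hu S hmax, hv S hmax⟩
  · obtain ⟨S, hS, huvS⟩ : ∃ S, G.IsMaximumIndepSet S ∧ ¬ (u ∈ S ∧ v ∈ S) := by
      by_contra! hall
      exact hcore ⟨fun S hS ↦ (hall S hS).1, fun S hS ↦ (hall S hS).2⟩
    rw [← G.maximumIndepSet_card_eq_indepNum S hS]
    exact ((isIndepSet_sup_edge_iff huv).2 ⟨hS.isIndepSet, huvS⟩).card_le_indepNum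

lemma isAlphaPlusStable_iff [Finite V] : IsAlphaPlusStable G ↔ (core G).Subsingleton := by
  refine ⟨fun hG u hu v hv ↦ ?_, fun hG u v huv ↦ ?_⟩
  · by_contra huv
    obtain ⟨S, hS⟩ := G.maximumIndepSet_exists
    exact (indepNum_sup_edge_eq_iff huv).1
      (hG u v ⟨huv, hS.isIndepSet (hu S hS) (hv S hS) huv⟩) ⟨hu, hv⟩
  · exact (indepNum_sup_edge_eq_iff huv.ne).2 fun ⟨hu, hv⟩ ↦ huv.ne (hG hu hv)

lemma mem_core_of_isolated [Finite V] (hv : ∀ w, ¬ G.Adj v w) : v ∈ core G := by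
  classical
  intro S hS
  by_contra hvS
  have hins : G.IsIndepSet (insert v S : Finset V) := by
    rw [coe_insert]
    exact hS.isIndepSet.insert fun w _ _ ↦ ⟨hv w, fun hwv ↦ hv w hwv.symm⟩
  have := hS.maximum _ hins
  rw [card_insert_of_notMem hvS] at this
  lia

lemma IsBicoloring.isIndepSet_inter_union_union [DecidableEq V] (h : IsBicoloring G A B)
    (hS : G.IsIndepSet (S : Set V)) (hT : G.IsIndepSet (T : Set V)) :
    G.IsIndepSet (S ∩ T ∩ A ∪ (S ∪ T) ∩ B : Finset V) := by
  refine h.isIndepSet_iff.2 fun u hu huA v hv hvB huv ↦ ?_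
  have huB := h.notMem_right_iff.2 huA
  have hvA := h.notMem_left_iff.2 hvB
  simp only [mem_union, mem_inter, huA, huB, hvA, hvB, and_true, and_false, or_false,
    false_or] at hu hv
  exact hv.elim (hS hu.1 · huv.ne huv) (hT hu.2 · huv.ne huv)

lemma IsBicoloring.isMaximumIndepSet_inter_union_union [Finite V] [DecidableEq V]
    (h : IsBicoloring G A B) (hS : G.IsMaximumIndepSet S) (hT : G.IsMaximumIndepSet T) :
    G.IsMaximumIndepSet (S ∩ T ∩ A ∪ (S ∪ T) ∩ B) := by
  have hindep := h.isIndepSet_inter_union_union hS.isIndepSet hT.isIndepSet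
  have hle := hS.maximum _ (h.symm.isIndepSet_inter_union_union hS.isIndepSet hT.isIndepSet)
  refine ⟨hindep, fun U hU ↦ (hS.maximum U hU).trans ?_⟩
  have hdisj := h.disjoint.mono (inter_subset_right : S ∩ T ∩ A ⊆ A)
    (inter_subset_right : (S ∪ T) ∩ B ⊆ B)
  have hdisj' := h.disjoint.symm.mono (inter_subset_right : S ∩ T ∩ B ⊆ B)
    (inter_subset_right : (S ∪ T) ∩ A ⊆ A)
  rw [card_union_of_disjoint hdisj'] at hle
  rw [card_union_of_disjoint hdisj]
  have := card_union_add_card_inter S T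
  have := h.card_inter_add_card_inter (S ∩ T)
  have := h.card_inter_add_card_inter (S ∪ T)
  have := hT.maximum S hS.isIndepSet
  lia

lemma IsBicoloring.exists_isMaximumIndepSet_inter_subset_core [Finite V] [DecidableEq V]
    (h : IsBicoloring G A B) :
    ∃ S, G.IsMaximumIndepSet S ∧ ((S ∩ A : Finset V) : Set V) ⊆ core G := by
  obtain ⟨S, hS, hmin⟩ := Set.exists_min_image {S | G.IsMaximumIndepSet S} (fun S ↦ #(S ∩ A))
    (Set.toFinite _) G.maximumIndepSet_exists
  refine ⟨S, hS, fun v hv T hT ↦ ?_⟩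
  have hinter : (S ∩ T ∩ A ∪ (S ∪ T) ∩ B) ∩ A = S ∩ T ∩ A := by
    rw [union_inter_distrib_right, inter_assoc _ B A,
      disjoint_iff_inter_eq_empty.1 h.disjoint.symm, inter_empty, union_empty, inter_assoc _ A A,
      inter_self]
  have hle := hmin _ (h.isMaximumIndepSet_inter_union_union hS hT)
  rw [hinter] at hle
  have hsub : S ∩ T ∩ A ⊆ S ∩ A := inter_subset_inter_right inter_subset_left
  rw [mem_coe, ← eq_of_subset_of_card_le hsub hle] at hv
  exact (mem_inter.1 (mem_inter.1 hv).1).2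

lemma IsAlphaPlusStable.exists_isMaximumIndepSet [Finite V] [DecidableEq V]
    (hG : IsAlphaPlusStable G) (h : IsBicoloring G A B) :
    ∃ S T, G.IsMaximumIndepSet S ∧ G.IsMaximumIndepSet T ∧ #(S ∩ A) + #(T ∩ B) ≤ 1 := by
  obtain ⟨S, hS, hSA⟩ := h.exists_isMaximumIndepSet_inter_subset_core
  obtain ⟨T, hT, hTB⟩ := h.symm.exists_isMaximumIndepSet_inter_subset_core
  refine ⟨S, T, hS, hT, ?_⟩
  have hcore : ((S ∩ A ∪ T ∩ B : Finset V) : Set V) ⊆ core G := by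
    rw [coe_union]
    exact Set.union_subset hSA hTB
  rw [← card_union_of_disjoint (h.disjoint.mono inter_subset_right inter_subset_right)]
  exact card_le_one_iff_subsingleton.2 ((isAlphaPlusStable_iff.1 hG).anti hcore)

lemma IsAlphaPlusStable.hasPerfectMatching [Finite V] (hG : IsAlphaPlusStable G)
    (h : IsBicoloring G A B) (hAB : #A = #B) : HasPerfectMatching G := by
  classical
  obtain ⟨S, T, hS, hT, hST⟩ := hG.exists_isMaximumIndepSet h
  refine (h.hallCondition_iff.2 fun U hU ↦ ?_).hasPerfectMatching h hAB
  have := hS.maximum U hU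
  have := hT.maximum U hU
  have := h.card_inter_add_card_inter S
  have := h.card_inter_add_card_inter T
  have := card_le_card (inter_subset_right : S ∩ B ⊆ B)
  have := card_le_card (inter_subset_right : T ∩ A ⊆ A)
  lia

lemma IsAlphaPlusStable.exists_isolated [Finite V] (hG : IsAlphaPlusStable G)
    (h : IsBicoloring G A B) (hlt : #B < #A) : ∃ v ∈ A, ∀ w, ¬ G.Adj v w := by
  classical
  obtain ⟨S, T, hS, -, hST⟩ := hG.exists_isMaximumIndepSet h
  have hAS := hS.maximum A h.isIndepSet_left
  have hcard := h.card_add_ncard_nbhd_le hS.isIndepSet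
  have hN : nbhd G (S ∩ A) = ∅ := (Set.ncard_eq_zero (Set.toFinite _)).1 (by lia)
  obtain ⟨v, hv⟩ := card_pos.1 (show 0 < #(S ∩ A) by lia)
  exact ⟨v, (mem_inter.1 hv).2, fun w hvw ↦ Set.eq_empty_iff_forall_notMem.1 hN w
    (mem_nbhd.2 ⟨v, hv, hvw⟩)⟩

lemma HasPerfectMatching.isAlphaPlusStable [Finite V] (hG : HasPerfectMatching G)
    (h : IsBicoloring G A B) : IsAlphaPlusStable G := by
  obtain ⟨hAB, hA⟩ := h.hasPerfectMatching_iff.1 hG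
  have hle := h.hallCondition_iff.1 hA
  rw [isAlphaPlusStable_iff]
  intro v hv
  have hvA : v ∈ A := hv A ⟨h.isIndepSet_left, hAB ▸ hle⟩
  have hvB : v ∈ B := hv B ⟨h.isIndepSet_right, hle⟩
  exact (h.notMem_right_iff.2 hvA hvB).elim

end Core

section DeletePair

/-- The part of a color class that survives in `G - a - b`. -/
noncomputable def restrictClass (A : Finset V) (a b : V) : Finset ({a, b}ᶜ : Set V) :=
  A.preimage Subtype.val Subtype.val_injective.injOn

lemma mem_restrictClass {w : ({a, b}ᶜ : Set V)} : w ∈ restrictClass A a b ↔ w.1 ∈ A :=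
  mem_preimage

lemma IsBicoloring.restrict (h : IsBicoloring G A B) (a b : V) :
    IsBicoloring (deletePair G a b) (restrictClass A a b) (restrictClass B a b) where
  isBipartiteWith := {
    disjoint := disjoint_coe.2 <| disjoint_left.2 fun _ hA hB ↦
      disjoint_left.1 h.disjoint (mem_restrictClass.1 hA) (mem_restrictClass.1 hB)
    mem_of_adj := fun _ _ hadj ↦ by
      simp only [mem_coe, mem_restrictClass]
      exact h.isBipartiteWith.mem_of_adj hadj }
  mem_or_mem w := by simpa only [mem_restrictClass] using h.mem_or_mem w

lemma map_restrictClass [DecidableEq V] (A : Finset V) (a b : V) :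
    (restrictClass A a b).map (.subtype _) = A \ {a, b} := by
  ext v
  simp only [mem_map, mem_restrictClass, Function.Embedding.subtype_apply, Subtype.exists,
    Set.mem_compl_iff, Set.mem_insert_iff, Set.mem_singleton_iff, mem_sdiff, mem_insert,
    mem_singleton]
  grind

lemma card_restrictClass [DecidableEq V] (A : Finset V) (a b : V) :
    #(restrictClass A a b) = #(A \ {a, b}) := by
  rw [← map_restrictClass, card_map]

lemma IsBicoloring.card_restrictClass_left (h : IsBicoloring G A B) (ha : a ∈ A) (hb : b ∈ B) :
    #(restrictClass A a b) + 1 = #A := by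
  classical
  rw [card_restrictClass, pair_comm, sdiff_insert_of_notMem (h.notMem_left_iff.2 hb),
    sdiff_singleton_eq_erase, card_erase_add_one ha]

lemma IsBicoloring.card_restrictClass_right (h : IsBicoloring G A B) (ha : a ∈ A) (hb : b ∈ B) :
    #(restrictClass B a b) + 1 = #B := by
  classical
  rw [← h.symm.card_restrictClass_left hb ha, card_restrictClass, card_restrictClass, pair_comm]

lemma ncard_nbhd_deletePair (X : Finset ({a, b}ᶜ : Set V)) :
    (nbhd (deletePair G a b) X).ncard = (nbhd G (X.map (.subtype _)) \ {a, b}).ncard := by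
  rw [← Set.ncard_image_of_injective _ Subtype.val_injective]
  congr 1
  ext v
  simp only [Set.mem_image, mem_nbhd, Set.mem_sdiff, mem_map, Subtype.exists,
    Function.Embedding.subtype_apply, deletePair, comap_adj]
  grind

lemma IsBicoloring.hallCondition_deletePair_iff [DecidableEq V] (h : IsBicoloring G A B)
    (ha : a ∈ A) (hb : b ∈ B) :
    HallCondition (deletePair G a b) (restrictClass A a b) ↔
      ∀ X ⊆ A.erase a, #X ≤ (nbhd G X \ {b}).ncard := by
  have hN : ∀ X ⊆ A, nbhd G X \ {a, b} = nbhd G X \ {b} := fun X hX ↦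
    Set.sdiff_insert_of_notMem fun haX ↦ h.notMem_right_iff.2 ha (h.nbhd_subset hX haX)
  refine ⟨fun hH X hX ↦ ?_, fun hH X hX ↦ ?_⟩
  · have hXA := hX.trans (A.erase_subset a)
    have hXab : X \ {a, b} = X := sdiff_eq_self_of_disjoint <| disjoint_insert_right.2
      ⟨(subset_erase.1 hX).2,
        disjoint_singleton_right.2 fun hbX ↦ h.notMem_left_iff.2 hb (hXA hbX)⟩
    have := hH (restrictClass X a b) fun w hw ↦
      mem_restrictClass.2 (hXA (mem_restrictClass.1 hw))
    rwa [ncard_nbhd_deletePair, card_restrictClass, map_restrictClass, hXab, hN X hXA] at this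
  · have hXA : X.map (.subtype _) ⊆ A.erase a := by
      rw [erase_eq, subset_sdiff, disjoint_singleton_right]
      simp only [subset_iff, mem_map, Function.Embedding.subtype_apply]
      exact ⟨fun v ⟨w, hw, hwv⟩ ↦ hwv ▸ mem_restrictClass.1 (hX hw),
        fun ⟨w, _, hwa⟩ ↦ w.2 (.inl hwa)⟩
    rw [ncard_nbhd_deletePair, hN _ (hXA.trans (A.erase_subset a)), ← card_map (.subtype _)]
    exact hH _ hXA

lemma IsBicoloring.hasPerfectMatching_deletePair_iff [Finite V] [DecidableEq V]
    (h : IsBicoloring G A B) (ha : a ∈ A) (hb : b ∈ B) :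
    HasPerfectMatching (deletePair G a b) ↔
      #A = #B ∧ ∀ X ⊆ A.erase a, #X ≤ (nbhd G X \ {b}).ncard := by
  rw [(h.restrict a b).hasPerfectMatching_iff, h.hallCondition_deletePair_iff ha hb,
    ← h.card_restrictClass_left ha hb, ← h.card_restrictClass_right ha hb, add_left_inj]

lemma IsBicoloring.forall_hasPerfectMatching_deletePair_iff [Finite V] (h : IsBicoloring G A B)
    (hA : A.Nonempty) (hB : B.Nonempty) :
    (∀ a ∈ A, ∀ b ∈ B, HasPerfectMatching (deletePair G a b)) ↔ #A = #B ∧ HasSurplus G A := by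
  classical
  have hiff := fun a (ha : a ∈ A) b (hb : b ∈ B) ↦ h.hasPerfectMatching_deletePair_iff ha hb
  refine ⟨fun hG ↦ ?_, fun ⟨hAB, hA⟩ a ha b hb ↦ (hiff a ha b hb).2 ⟨hAB, fun X hX ↦ ?_⟩⟩
  · obtain ⟨a, ha⟩ := hA
    obtain ⟨b, hb⟩ := hB
    refine ⟨((hiff a ha b hb).1 (hG a ha b hb)).1, fun X hX hXA ↦ ?_⟩
    obtain ⟨a, ha, haX⟩ := exists_of_ssubset hXA
    have hXa : X ⊆ A.erase a := subset_erase.2 ⟨hXA.subset, haX⟩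
    have hle : ∀ b ∈ B, #X ≤ (nbhd G X \ {b}).ncard := fun b hb ↦
      ((hiff a ha b hb).1 (hG a ha b hb)).2 X hXa
    obtain ⟨c, hc, -⟩ := (Set.ncard_pos (Set.toFinite _)).1 (hX.card_pos.trans_le (hle b hb))
    exact (hle c (h.nbhd_subset hXA.subset hc)).trans_lt
      (Set.ncard_sdiff_singleton_lt_of_mem hc (Set.toFinite _))
  · obtain rfl | hXne := X.eq_empty_or_nonempty
    · simp
    have hlt := hA X hXne (hX.trans_ssubset (erase_ssubset ha))
    have := Set.ncard_le_ncard_sdiff_add_ncard (nbhd G X) {b} (Set.toFinite _)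
    rw [Set.ncard_singleton] at this
    lia

lemma IsBicoloring.exists_forall_adj_eq_of_isAlphaPlusStable_deletePair [Finite V]
    (h : IsBicoloring G A B) (ha : a ∈ A) (hb : b ∈ B) (hlt : #B < #A)
    (hG : IsAlphaPlusStable (deletePair G a b)) : ∃ v ∈ A, v ≠ a ∧ ∀ w, G.Adj v w → w = b := by
  have := h.card_restrictClass_left ha hb
  have := h.card_restrictClass_right ha hb
  obtain ⟨v, hv, hviso⟩ := hG.exists_isolated (h.restrict a b) (by lia)
  rw [mem_restrictClass] at hv
  refine ⟨v, hv, fun hva ↦ v.2 (.inl hva), fun w hvw ↦ ?_⟩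
  by_contra hwb
  have hwa : w ≠ a := fun hwa ↦ h.notMem_right_iff.2 ha (hwa ▸ h.mem_right_of_adj hv hvw)
  exact hviso ⟨w, by simp [hwa, hwb]⟩ hvw

lemma IsBicoloring.card_le_card_of_isAlphaPlusStable_deletePair [Finite V]
    (h : IsBicoloring G A B) (hV : 4 ≤ #A + #B) (hB : B.Nonempty)
    (hG : ∀ a ∈ A, ∀ b ∈ B, IsAlphaPlusStable (deletePair G a b)) : #A ≤ #B := by
  classical
  by_contra! hlt
  obtain ⟨b, hb⟩ := hB
  obtain ⟨a, ha⟩ := card_pos.1 (show 0 < #A by lia)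
  have hexists := fun a (ha : a ∈ A) ↦
    h.exists_forall_adj_eq_of_isAlphaPlusStable_deletePair ha hb hlt (hG a ha b hb)
  obtain ⟨x, hx, -, hxb⟩ := hexists a ha
  obtain ⟨y, hy, hyx, hyb⟩ := hexists x hx
  obtain ⟨z, hz, hzxy⟩ := exists_mem_notMem_of_card_lt_card
    (show #{x, y} < #A from card_le_two.trans_lt (by lia))
  simp only [mem_insert, mem_singleton, not_or] at hzxy
  have hcore : ∀ v (hv : v ∈ ({z, b}ᶜ : Set V)), (∀ w, G.Adj v w → w = b) →
      ⟨v, hv⟩ ∈ core (deletePair G z b) := fun v hv hvb ↦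
    mem_core_of_isolated fun w hvw ↦ w.2 (.inr (hvb w hvw))
  have hmem : ∀ v ∈ A, z ≠ v → v ∈ ({z, b}ᶜ : Set V) := fun v hv hzv ↦ by
    rintro (rfl | rfl)
    exacts [hzv rfl, h.notMem_left_iff.2 hb hv]
  have hxy := isAlphaPlusStable_iff.1 (hG z hz b hb) (hcore x (hmem x hx hzxy.1) hxb)
    (hcore y (hmem y hy hzxy.2) hyb)
  exact hyx (congrArg Subtype.val hxy).symm

lemma IsBicoloring.forall_isAlphaPlusStable_deletePair_iff [Finite V] (h : IsBicoloring G A B)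
    (hV : 4 ≤ #A + #B) (hA : A.Nonempty) (hB : B.Nonempty) :
    (∀ a ∈ A, ∀ b ∈ B, IsAlphaPlusStable (deletePair G a b)) ↔
      ∀ a ∈ A, ∀ b ∈ B, HasPerfectMatching (deletePair G a b) := by
  refine ⟨fun hG a ha b hb ↦ ?_, fun hG a ha b hb ↦
    (hG a ha b hb).isAlphaPlusStable (h.restrict a b)⟩
  have hAB : #A = #B := by
    refine (h.card_le_card_of_isAlphaPlusStable_deletePair hV hB hG).antisymm
      (h.symm.card_le_card_of_isAlphaPlusStable_deletePair (by lia) hA fun b hb a ha ↦ ?_)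
    have := hG a ha b hb
    rwa [deletePair, Set.pair_comm] at this
  refine (hG a ha b hb).hasPerfectMatching (h.restrict a b) ?_
  have := h.card_restrictClass_left ha hb
  have := h.card_restrictClass_right ha hb
  lia

lemma HasPerfectMatching.exists_isPerfectMatching_adj (hab : G.Adj a b)
    (hG : HasPerfectMatching (deletePair G a b)) :
    ∃ M : G.Subgraph, M.IsPerfectMatching ∧ M.Adj a b := by
  obtain ⟨M, hM⟩ := hG
  let f : deletePair G a b →g G := (Embedding.induce _).toHom
  have hverts : (M.map f).verts = {a, b}ᶜ := by
    rw [Subgraph.map_verts, hM.2.verts_eq_univ, Set.image_univ]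
    exact Subtype.range_coe
  have hmap : (M.map f).IsMatching := hM.1.map f Subtype.val_injective
  refine ⟨M.map f ⊔ G.subgraphOfAdj hab, ⟨hmap.sup (.subgraphOfAdj hab) ?_, fun v ↦ ?_⟩,
    .inr (by simp)⟩
  · rw [hmap.support_eq_verts, (Subgraph.IsMatching.subgraphOfAdj hab).support_eq_verts, hverts]
    exact disjoint_compl_left
  · rw [Subgraph.verts_sup, hverts]
    exact (em (v ∈ ({a, b} : Set V))).symm

end DeletePair

section Elementary

lemma IsBicoloring.everyEdgeMatched (h : IsBicoloring G A B)
    (hG : ∀ a ∈ A, ∀ b ∈ B, HasPerfectMatching (deletePair G a b)) : EveryEdgeMatched G := by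
  intro u v huv
  rcases h.mem_or_mem u with hu | hu
  · exact (hG u hu v (h.mem_right_of_adj hu huv)).exists_isPerfectMatching_adj huv
  · obtain ⟨M, hM, hvu⟩ :=
      (hG v (h.mem_left_of_adj hu huv) u hu).exists_isPerfectMatching_adj huv.symm
    exact ⟨M, hM, hvu.symm⟩

-- Otherwise `m` would embed `N(X)` into `X`, where `X` is the set of those `x ∈ A` with `P x`.
lemma HasSurplus.forall_of_closed [Finite V] (hA : HasSurplus G A) (h : IsBicoloring G A B)
    {m : V → V} (hm : IsMate G m) {P : V → Prop}
    (hP : ∀ x ∈ A, P x → ∀ b, G.Adj x b → P (m b)) (ha : a ∈ A) (hPa : P a) : ∀ x ∈ A, P x := by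
  classical
  by_contra! hex
  obtain ⟨z, hz, hPz⟩ := hex
  set X := {x ∈ A | P x}
  have hXA : X ⊂ A := filter_ssubset.2 ⟨z, hz, hPz⟩
  refine (hA X ⟨a, mem_filter.2 ⟨ha, hPa⟩⟩ hXA).not_ge ?_
  rw [← Set.ncard_coe_finset X]
  refine Set.ncard_le_ncard_of_injOn m (fun b hb ↦ ?_) hm.involutive.injective.injOn
    (Set.toFinite _)
  obtain ⟨x, hx, hxb⟩ := mem_nbhd.1 hb
  obtain ⟨hxA, hPx⟩ := mem_filter.1 hx
  exact mem_filter.2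
    ⟨h.mem_left_of_adj (h.mem_right_of_adj hxA hxb) (hm.adj b), hP x hxA hPx b hxb⟩

lemma HasSurplus.connected [Finite V] (hA : HasSurplus G A) (h : IsBicoloring G A B)
    {m : V → V} (hm : IsMate G m) (hne : A.Nonempty) : G.Connected := by
  obtain ⟨a, ha⟩ := hne
  have hreach : ∀ x ∈ A, G.Reachable a x := hA.forall_of_closed h hm
    (fun _ _ hax b hxb ↦ (hax.trans hxb.reachable).trans (hm.adj b).reachable) ha .rfl
  refine (connected_iff_exists_forall_reachable G).2 ⟨a, fun v ↦ ?_⟩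
  rcases h.mem_or_mem v with hv | hv
  · exact hreach v hv
  · exact (hreach _ (h.mem_left_of_adj hv (hm.adj v))).trans (hm.adj v).symm.reachable

lemma EveryEdgeMatched.isElementary [Nontrivial V] (hG : EveryEdgeMatched G)
    (hc : G.Connected) : IsElementary G := by
  have hadj : ∀ u v, G.Adj u v → (sSup {M : G.Subgraph | M.IsPerfectMatching}).Adj u v :=
    fun u v huv ↦ Subgraph.sSup_adj.2 (hG u v huv)
  have htop : sSup {M : G.Subgraph | M.IsPerfectMatching} = ⊤ := by
    refine top_unique ⟨fun v _ ↦ ?_, fun u v huv ↦ hadj u v huv⟩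
    obtain ⟨w, hw⟩ := hc.preconnected.exists_adj_of_nontrivial v
    exact (hadj v w hw).fst_mem
  rw [IsElementary, htop, Subgraph.connected_iff']
  exact Subgraph.topIso.connected_iff.2 hc

lemma IsElementary.hasPerfectMatching (hG : IsElementary G) : HasPerfectMatching G := by
  obtain ⟨v, hv⟩ := hG.nonempty
  rw [Subgraph.verts_sSup, Set.mem_iUnion₂] at hv
  obtain ⟨M, hM, -⟩ := hv
  exact ⟨M, hM⟩

lemma IsElementary.forall_mem_of_closed (hG : IsElementary G) {S : Set V}
    (hS : ∀ M : G.Subgraph, M.IsPerfectMatching → ∀ u v, M.Adj u v → u ∈ S → v ∈ S)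
    (hu : u ∈ S) (v : V) : v ∈ S := by
  have hspan : ∀ z, z ∈ (sSup {M : G.Subgraph | M.IsPerfectMatching}).verts := fun z ↦ by
    obtain ⟨M, hM⟩ := hG.hasPerfectMatching
    rw [Subgraph.verts_sSup]
    exact Set.mem_iUnion₂.2 ⟨M, hM, hM.2 z⟩
  by_contra hv
  obtain ⟨p⟩ := hG.coe.preconnected ⟨u, hspan u⟩ ⟨v, hspan v⟩
  obtain ⟨d, -, hfst, hsnd⟩ := p.exists_boundary_dart (Subtype.val ⁻¹' S) hu hv
  obtain ⟨M, hM, hMd⟩ := Subgraph.sSup_adj.1 d.adj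
  exact hsnd (hS M hM _ _ hMd hfst)

lemma IsElementary.card_eq [Finite V] (hG : IsElementary G) (h : IsBicoloring G A B) :
    #A = #B :=
  (h.hasPerfectMatching_iff.1 hG.hasPerfectMatching).1

lemma IsMate.image_eq_nbhd [Finite V] {m : V → V} (hm : IsMate G m)
    (hX : (nbhd G X).ncard ≤ #X) : m '' X = nbhd G X := by
  refine Set.eq_of_subset_of_ncard_le ?_ ?_ (Set.toFinite _)
  · rintro _ ⟨x, hx, rfl⟩
    exact mem_nbhd.2 ⟨x, hx, hm.adj x⟩
  · rwa [Set.ncard_image_of_injective _ hm.involutive.injective, Set.ncard_coe_finset]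

lemma IsElementary.hasSurplus [Finite V] (hG : IsElementary G) (h : IsBicoloring G A B) :
    HasSurplus G A := by
  intro X ⟨x, hx⟩ hXA
  by_contra! htight
  have hclosed : ∀ M : G.Subgraph, M.IsPerfectMatching → ∀ u v, M.Adj u v →
      u ∈ (X : Set V) ∪ nbhd G X → v ∈ (X : Set V) ∪ nbhd G X := by
    intro M hM u v huv hu
    obtain ⟨m, hm, hMm⟩ := exists_isMate_of_isPerfectMatching hM
    obtain rfl := (hMm u v).1 huv
    rw [← hm.image_eq_nbhd htight] at hu ⊢
    rcases hu with hu | ⟨y, hy, rfl⟩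
    · exact .inr ⟨u, hu, rfl⟩
    · exact .inl (by rwa [hm.involutive y])
  obtain ⟨a, ha, haX⟩ := exists_of_ssubset hXA
  rcases hG.forall_mem_of_closed hclosed (.inl hx) a with haX' | haN
  · exact haX haX'
  · exact h.notMem_right_iff.2 ha (h.nbhd_subset hXA.subset haN)

end Elementary

section Necessity

lemma isIndepSet_anti {H H' : SimpleGraph V} {s : Set V} (hHH' : H ≤ H') (hs : H'.IsIndepSet s) :
    H.IsIndepSet s :=
  hs.mono' fun _ _ hst hH ↦ hst (hHH' hH)

lemma IsEar.isPath_inner {H : G.Subgraph} {x y : V} {hux : G.Adj u x} {q : G.Walk x y}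
    {hyv : G.Adj y v} (hp : IsEar A B H (.cons hux (q.concat hyv))) :
    q.IsPath ∧ ∀ w ∈ q.support, w ∉ H.verts := by
  have hpath := hp.isPath
  rw [Walk.cons_isPath_iff, Walk.concat_isPath_iff, Walk.support_concat] at hpath
  obtain ⟨⟨hq, hvq⟩, huq⟩ := hpath
  refine ⟨hq, fun w hw hwH ↦ ?_⟩
  rcases hp.inter w (by simp [hw]) hwH with rfl | rfl
  exacts [huq (List.mem_append_left _ hw), hvq hw]

lemma toSubgraph_cons_concat {x y : V} (hux : G.Adj u x) (q : G.Walk x y) (hyv : G.Adj y v) :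
    (Walk.cons hux (q.concat hyv)).toSubgraph =
      G.subgraphOfAdj hux ⊔ (q.toSubgraph ⊔ G.subgraphOfAdj hyv) := by
  rw [Walk.toSubgraph, Walk.concat_eq_append, Walk.toSubgraph_append,
    Walk.toSubgraph_cons_nil_eq_subgraphOfAdj]

variable [DecidableEq V]

-- `q` traverses pairs `b, a` with `b ∈ B` and `a ∈ A`, and `S` contains at most one vertex of each.
lemma IsBicoloring.countP_support_le (h : IsBicoloring G A B) {x y : V} (hx : x ∈ B) (hy : y ∈ A) :
    ∀ q : G.Walk x y, q.toSubgraph.spanningCoe.IsIndepSet (S : Set V) →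
      q.support.countP (· ∈ S) ≤ q.support.countP (· ∈ A) ∧
      (q.support.countP (· ∈ S) = q.support.countP (· ∈ A) → x ∉ S →
        ∀ z ∈ q.support, z ∈ S ↔ z ∈ A)
  | .nil, _ => absurd hx (h.notMem_right_iff.2 hy)
  | .cons hxy .nil, hS => by
    have hxA := h.notMem_left_iff.2 hx
    have hxyS : x ∈ S → y ∉ S := fun hxS hyS ↦ hS hxS hyS hxy.ne (by simp [hxy.ne])
    simp only [Walk.support_cons, Walk.support_nil, List.countP_cons, List.countP_nil]
    grind
  | .cons (v := a) hxa (.cons (v := b) hab r), hS => by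
    have hxA := h.notMem_left_iff.2 hx
    have ha := h.mem_left_of_adj hx hxa
    have hb := h.mem_right_of_adj ha hab
    have hxaS : x ∈ S → a ∉ S := fun hxS haS ↦ hS hxS haS hxa.ne (by simp [hxa.ne])
    have habS : a ∈ S → b ∉ S := fun haS hbS ↦ hS haS hbS hab.ne (by simp [hab.ne])
    obtain ⟨hle, heq⟩ := h.countP_support_le hb hy r
      (isIndepSet_anti (fun _ _ hr ↦ Or.inr (.inr hr)) hS)
    simp only [Walk.support_cons, List.countP_cons]
    grind
  termination_by q => q.length

lemma card_inter_support {x y : V} {q : G.Walk x y} (hq : q.IsPath) (S : Finset V) :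
    #(S ∩ q.support.toFinset) = q.support.countP (· ∈ S) := by
  have hfilter : S ∩ q.support.toFinset = (q.support.filter (· ∈ S)).toFinset := by
    ext
    simp [and_comm]
  rw [hfilter, List.toFinset_card_of_nodup (hq.support_nodup.filter _),
    List.countP_eq_length_filter]

lemma IsBicoloring.card_inter_support_le (h : IsBicoloring G A B) {x y : V} (hx : x ∈ B)
    (hy : y ∈ A) {q : G.Walk x y} (hq : q.IsPath)
    (hS : q.toSubgraph.spanningCoe.IsIndepSet (S : Set V)) :
    #(S ∩ q.support.toFinset) ≤ #(A ∩ q.support.toFinset) := by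
  rw [card_inter_support hq, card_inter_support hq]
  exact (h.countP_support_le hx hy q hS).1

lemma IsBicoloring.inter_support_eq (h : IsBicoloring G A B) {x y : V} (hx : x ∈ B)
    (hy : y ∈ A) {q : G.Walk x y} (hq : q.IsPath)
    (hS : q.toSubgraph.spanningCoe.IsIndepSet (S : Set V))
    (hcard : #(A ∩ q.support.toFinset) ≤ #(S ∩ q.support.toFinset)) (hxS : x ∉ S) :
    S ∩ q.support.toFinset = A ∩ q.support.toFinset := by
  have hcard := (h.card_inter_support_le hx hy hq hS).antisymm hcard
  rw [card_inter_support hq, card_inter_support hq] at hcard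
  ext z
  simp only [mem_inter, List.mem_toFinset]
  exact and_congr_left ((h.countP_support_le hx hy q hS).2 hcard hxS z)

lemma IsBicoloring.card_left_inter_support (h : IsBicoloring G A B) {x y : V} (hx : x ∈ B)
    (hy : y ∈ A) {q : G.Walk x y} (hq : q.IsPath) :
    #(A ∩ q.support.toFinset) = #(B ∩ q.support.toFinset) := by
  have hindep : ∀ {C : Finset V} {s t : V} (r : G.Walk s t), G.IsIndepSet (C : Set V) →
      r.toSubgraph.spanningCoe.IsIndepSet (C : Set V) := fun r hC ↦
    isIndepSet_anti r.toSubgraph.spanningCoe_le hC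
  refine le_antisymm ?_ (h.card_inter_support_le hx hy hq (hindep q h.isIndepSet_right))
  simpa using h.symm.card_inter_support_le hy hx hq.reverse (hindep q.reverse h.isIndepSet_left)

/-- The analogue of `IsBistable` for a graph `H` with vertex set `W ⊆ V`: the stable sets of `H` of
at least the size of its color classes are the color classes themselves. -/
structure IsBistableOn (H : SimpleGraph V) (A B W : Finset V) : Prop where
  card_eq : #(A ∩ W) = #(B ∩ W)
  eq_or_eq : ∀ S ⊆ W, H.IsIndepSet (S : Set V) → #(A ∩ W) ≤ #S → S = A ∩ W ∨ S = B ∩ W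

lemma IsBistableOn.mono {H H' : SimpleGraph V} {W : Finset V} (hH : IsBistableOn H A B W)
    (hHH' : H ≤ H') : IsBistableOn H' A B W where
  card_eq := hH.card_eq
  eq_or_eq S hSW hS := hH.eq_or_eq S hSW (isIndepSet_anti hHH' hS)

lemma IsBistableOn.addEar {H H' : SimpleGraph V} {W : Finset V} (hH : IsBistableOn H A B W)
    (h : IsBicoloring G A B) (hHH' : H ≤ H') {u x y v : V} {q : G.Walk x y} (hq : q.IsPath)
    (hqH' : q.toSubgraph.spanningCoe ≤ H') (hux : H'.Adj u x) (hyv : H'.Adj y v)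
    (hu : u ∈ A ∩ W) (hv : v ∈ B ∩ W) (hx : x ∈ B) (hy : y ∈ A)
    (hWq : Disjoint W q.support.toFinset) :
    IsBistableOn H' A B (W ∪ q.support.toFinset) := by
  set Q := q.support.toFinset
  have hcard : ∀ C : Finset V, #(C ∩ (W ∪ Q)) = #(C ∩ W) + #(C ∩ Q) := fun C ↦ by
    rw [inter_union_distrib_left,
      card_union_of_disjoint (hWq.mono inter_subset_right inter_subset_right)]
  have hAB : #(A ∩ Q) = #(B ∩ Q) := h.card_left_inter_support hx hy hq
  refine ⟨by rw [hcard, hcard, hH.card_eq, hAB], fun S hSW hS hAS ↦ ?_⟩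
  have hSQ : q.toSubgraph.spanningCoe.IsIndepSet (S : Set V) :=
    isIndepSet_anti hqH' hS
  have hSQ' : q.reverse.toSubgraph.spanningCoe.IsIndepSet (S : Set V) := by
    rwa [Walk.toSubgraph_reverse]
  have hle : #(S ∩ Q) ≤ #(A ∩ Q) := h.card_inter_support_le hx hy hq hSQ
  have hsplit : S = S ∩ W ∪ S ∩ Q := by rw [← inter_union_distrib_left, inter_eq_left.2 hSW]
  rw [← inter_eq_left.2 hSW, hcard, hcard] at hAS
  have hSW' := hH.eq_or_eq (S ∩ W) inter_subset_right
    ((isIndepSet_anti hHH' hS).mono (coe_subset.2 inter_subset_left)) (by lia)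
  have hSA : #(S ∩ W) = #(A ∩ W) := hSW'.elim (congrArg card) fun hSB ↦ by rw [hSB, hH.card_eq]
  rw [inter_union_distrib_left, inter_union_distrib_left]
  rcases hSW' with hSW' | hSW'
  · have huS : u ∈ S := inter_subset_left (hSW' ▸ hu)
    have hxS : x ∉ S := fun hxS ↦ hS huS hxS hux.ne hux
    left
    rw [← hSW', ← h.inter_support_eq hx hy hq hSQ (by lia) hxS]
    exact hsplit
  · have hvS : v ∈ S := inter_subset_left (hSW' ▸ hv)
    have hyS : y ∉ S := fun hyS ↦ hS hyS hvS hyv.ne hyv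
    have hSQB := h.symm.inter_support_eq hy hx hq.reverse hSQ'
    rw [Walk.support_reverse, List.toFinset_reverse] at hSQB
    right
    rw [← hSW', ← hSQB (by lia) hyS]
    exact hsplit

lemma IsBicoloring.isBistableOn_edge (h : IsBicoloring G A B) (hu : u ∈ A) (hv : v ∈ B)
    {H : SimpleGraph V} (huv : H.Adj u v) : IsBistableOn H A B {u, v} := by
  have hA : A ∩ {u, v} = {u} := by
    rw [inter_insert_of_mem hu, inter_singleton_of_notMem (h.notMem_left_iff.2 hv)]
    rfl
  have hB : B ∩ {u, v} = {v} := by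
    rw [inter_insert_of_notMem (h.notMem_right_iff.2 hu), inter_singleton_of_mem hv]
  refine ⟨by simp [hA, hB], fun S hS hSind hle ↦ ?_⟩
  rw [hA, hB]
  rw [hA, card_singleton] at hle
  obtain ⟨w, hw⟩ := card_pos.1 hle
  have hne : u ∈ S → v ∉ S := fun huS hvS ↦ hSind huS hvS huv.ne huv
  have := mem_insert.1 (hS hw)
  grind

lemma IsEar.exists_isBistableOn {H : G.Subgraph} {p : G.Walk u v} (hp : IsEar A B H p)
    (h : IsBicoloring G A B) {W : Finset V} (hW : W = H.verts)
    (hH : IsBistableOn H.spanningCoe A B W) : ∃ W' : Finset V, W' = (H ⊔ p.toSubgraph).verts ∧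
      IsBistableOn (H ⊔ p.toSubgraph).spanningCoe A B W' := by
  have hHle : H.spanningCoe ≤ (H ⊔ p.toSubgraph).spanningCoe := fun _ _ ↦ .inl
  have huH := hp.start_mem
  have hvH := hp.end_mem
  have hu : u ∈ A ∩ W := mem_inter.2 ⟨hp.start_mem_class, mem_coe.1 (hW ▸ huH)⟩
  have hv : v ∈ B ∩ W := mem_inter.2 ⟨hp.end_mem_class, mem_coe.1 (hW ▸ hvH)⟩
  rcases p with _ | ⟨hux, _ | ⟨hxz, r⟩⟩
  · exact absurd hp.end_mem_class (h.notMem_right_iff.2 hp.start_mem_class)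
  · refine ⟨W, ?_, hH.mono hHle⟩
    rw [hW, Walk.toSubgraph_cons_nil_eq_subgraphOfAdj, Subgraph.verts_sup, subgraphOfAdj_verts]
    exact (Set.union_eq_left.2 (Set.pair_subset huH hvH)).symm
  · obtain ⟨y, q, hyv, hr⟩ := Walk.exists_cons_eq_concat hxz r
    rw [hr] at hp hHle ⊢
    obtain ⟨hq, hqH⟩ := hp.isPath_inner
    have hWq : Disjoint W q.support.toFinset := disjoint_left.2 fun w hwW hwq ↦
      hqH w (List.mem_toFinset.1 hwq) (hW ▸ hwW)
    have hx := h.mem_right_of_adj hp.start_mem_class hux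
    have hy := h.mem_left_of_adj hp.end_mem_class hyv.symm
    rw [toSubgraph_cons_concat] at hHle ⊢
    refine ⟨W ∪ q.support.toFinset, ?_, hH.addEar h hHle hq (fun _ _ hst ↦ .inr (.inr (.inl hst)))
      (by simp [hux.ne]) (by simp [hyv.ne]) hu hv hx hy hWq⟩
    ext w
    have := q.start_mem_support
    have := q.end_mem_support
    simp only [coe_union, hW, List.coe_toFinset, Subgraph.verts_sup, Walk.verts_toSubgraph,
      subgraphOfAdj_verts]
    grind

lemma EarBuilt.exists_isBistableOn {H : G.Subgraph} (hH : EarBuilt A B H)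
    (h : IsBicoloring G A B) :
    ∃ W : Finset V, W = H.verts ∧ IsBistableOn H.spanningCoe A B W := by
  induction hH with
  | @base u v huv =>
    rcases h.mem_or_mem u with hu | hu
    · exact ⟨{u, v}, by simp, h.isBistableOn_edge hu (h.mem_right_of_adj hu huv) (by simp [huv.ne])⟩
    · exact ⟨{v, u}, by simp [Set.pair_comm],
        h.isBistableOn_edge (h.mem_left_of_adj hu huv) hu (by simp [huv.ne'])⟩
  | addEar p _ hp ih =>
    obtain ⟨W, hW, hWH⟩ := ih
    exact hp.exists_isBistableOn h hW hWH

end Necessity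

lemma HasEarDecomposition.isBistable [Finite V] (hG : HasEarDecomposition G A B)
    (h : IsBicoloring G A B) : IsBistable G A B := by
  classical
  have := Fintype.ofFinite V
  obtain ⟨W, hW, hWG⟩ := EarBuilt.exists_isBistableOn hG h
  obtain rfl : W = univ := by simpa using hW
  have hcard := hWG.card_eq
  have heq := hWG.eq_or_eq
  simp only [inter_univ, subset_univ, Subgraph.spanningCoe_top, true_imp_iff] at hcard heq
  exact h.isBistable hcard heq

section Sufficiency

variable {x y : V} {m : V → V} {H : G.Subgraph} {W : Set V}

lemma IsBicoloring.even_length_iff (h : IsBicoloring G A B) (q : G.Walk x y) :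
    Even q.length ↔ (x ∈ B ↔ y ∈ B) := by
  classical
  have hvalid : ∀ {v w : V}, G.Adj v w → decide (v ∈ B) ≠ decide (w ∈ B) := fun {v w} hvw ↦ by
    rcases h.mem_or_mem v with hv | hv
    · simp [h.notMem_right_iff.2 hv, h.mem_right_of_adj hv hvw]
    · simp [hv, h.notMem_right_iff.2 (h.mem_left_of_adj hv hvw)]
  exact ((Coloring.mk (fun v ↦ decide (v ∈ B)) hvalid).even_length_iff_congr q).trans
    (iff_congr decide_eq_true_iff decide_eq_true_iff)

/-- The walk `q` leaves each vertex of `B` along the edge of the perfect matching described by the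
involution `m`. -/
def IsAlternating (B : Finset V) (m : V → V) (q : G.Walk x y) : Prop :=
  ∀ d ∈ q.darts, d.fst ∈ B → d.snd = m d.fst

lemma IsAlternating.mate_mem_support {q : G.Walk x y} (hq : IsAlternating B m q)
    (h : IsBicoloring G A B) (hm : IsMate G m) (hx : x ∈ B) {w : V} (hw : w ∈ q.support)
    (hwy : w ≠ y) : m w ∈ q.support := by
  rcases h.mem_or_mem w with hwA | hwB
  · rw [← Walk.cons_map_snd_darts, List.mem_cons, List.mem_map] at hw
    obtain rfl | ⟨d, hd, rfl⟩ := hw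
    · exact absurd hx (h.notMem_right_iff.2 hwA)
    · rw [hq d hd (h.mem_right_of_adj hwA d.adj.symm), hm.involutive]
      exact q.dart_fst_mem_support_of_mem_darts hd
  · rw [← Walk.map_fst_darts_append, List.mem_append, List.mem_singleton, List.mem_map] at hw
    obtain ⟨d, hd, rfl⟩ := hw.resolve_right hwy
    rw [← hq d hd hwB]
    exact q.dart_snd_mem_support_of_mem_darts hd

/-- Some alternating walk from `b` ends in a vertex of `W ∩ B` and has no other vertex in `W`. -/
def HasAlternatingWalkTo (G : SimpleGraph V) (B : Finset V) (m : V → V) (W : Set V) (b : V) :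
    Prop :=
  ∃ v ∈ B, v ∈ W ∧ ∃ q : G.Walk b v, IsAlternating B m q ∧ ∀ w ∈ q.support, w ∈ W → w = v

-- The vertices of `A` whose partner starts no such walk would form a set violating the surplus.
lemma HasSurplus.hasAlternatingWalkTo [Finite V] (hA : HasSurplus G A) (h : IsBicoloring G A B)
    (hm : IsMate G m) (hW : Set.MapsTo m W W) (hAW : a ∈ A) (haW : a ∈ W) (hb : b ∈ B) :
    HasAlternatingWalkTo G B m W b := by
  by_contra hbad
  have hend : ∀ c ∈ B, c ∈ W → HasAlternatingWalkTo G B m W c := fun c hc hcW ↦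
    ⟨c, hc, hcW, .nil, by simp [IsAlternating], by simp⟩
  have hclosed : ∀ x ∈ A, ¬ HasAlternatingWalkTo G B m W (m x) → ∀ c, G.Adj x c →
      ¬ HasAlternatingWalkTo G B m W (m (m c)) := by
    intro x hx hxbad c hxc hc
    rw [hm.involutive] at hc
    obtain ⟨v, hv, hvW, q, hq, hqW⟩ := hc
    have hmxB := h.mem_right_of_adj hx (hm.adj x)
    have hmxW : m x ∉ W := fun hmxW ↦ hxbad (hend _ hmxB hmxW)
    have hxW : x ∉ W := fun hxW ↦ hmxW (hW hxW)
    refine hxbad ⟨v, hv, hvW, .cons (hm.adj x).symm (.cons hxc q), ?_, ?_⟩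
    · simpa [IsAlternating, hm.involutive x, h.notMem_right_iff.2 hx] using hq
    · simpa [hmxW, hxW] using hqW
  refine hA.forall_of_closed h hm hclosed (h.mem_left_of_adj hb (hm.adj b)) ?_ a hAW
    (hend _ (h.mem_right_of_adj hAW (hm.adj a)) (hW haW))
  rwa [hm.involutive]

lemma IsBicoloring.isEar_cons {q : G.Walk b v} (h : IsBicoloring G A B) (hq : q.IsPath) (hu : u ∈ A)
    (huH : u ∈ H.verts) (hv : v ∈ B) (hvH : v ∈ H.verts)
    (hqH : ∀ w ∈ q.support, w ∈ H.verts → w = v) (hub : G.Adj u b) :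
    IsEar A B H (Walk.cons hub q) where
  isPath := hq.cons fun huq ↦ h.notMem_right_iff.2 hu (hqH u huq huH ▸ hv)
  even := by
    have hbB := h.mem_right_of_adj hu hub
    have : Even q.length := (h.even_length_iff q).2 (by simp [hbB, hv])
    rw [Walk.length_support, Walk.length_cons]
    exact this.add even_two
  start_mem_class := hu
  end_mem_class := hv
  start_mem := huH
  end_mem := hvH
  inter w hw hwH := by
    rw [Walk.support_cons, List.mem_cons] at hw
    exact hw.imp_right fun hw ↦ hqH w hw hwH

lemma HasSurplus.exists_isEar [Finite V] (hA : HasSurplus G A) (h : IsBicoloring G A B)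
    (hm : IsMate G m) (hH : Set.MapsTo m H.verts H.verts) (ha : a ∈ A) (haH : a ∈ H.verts)
    (hspan : ∃ z ∈ A, z ∉ H.verts) :
    ∃ (u v : V) (p : G.Walk u v), IsEar A B H p ∧
      Set.MapsTo m (H ⊔ p.toSubgraph).verts (H ⊔ p.toSubgraph).verts ∧
      ¬ p.toSubgraph ≤ H := by
  classical
  obtain ⟨u, hu, b, hub, huH, hbH⟩ :
      ∃ u ∈ A, ∃ b, G.Adj u b ∧ u ∈ H.verts ∧ b ∉ H.verts := by
    by_contra! hclosed
    obtain ⟨z, hz, hzH⟩ := hspan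
    exact hzH (hA.forall_of_closed h hm (fun x hx hxH b hxb ↦ hH (hclosed x hx b hxb hxH)) ha haH
      z hz)
  have hb := h.mem_right_of_adj hu hub
  obtain ⟨v, hv, hvH, q, hq, hqH⟩ := hA.hasAlternatingWalkTo h hm hH ha haH hb
  have hq' : IsAlternating B m q.bypass := fun d hd ↦ hq d (q.darts_bypass_subset_darts hd)
  have hmate : ∀ w ∈ q.bypass.support, m w ∈ H.verts ∨ m w ∈ q.bypass.support := fun w hw ↦ by
    obtain rfl | hwv := eq_or_ne w v
    · exact .inl (hH hvH)
    · exact .inr (hq'.mate_mem_support h hm hb hw hwv)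
  refine ⟨u, v, .cons hub q.bypass, h.isEar_cons q.bypass_isPath hu huH hv hvH
    (fun w hw ↦ hqH w (q.support_bypass_subset_support hw)) hub, fun w hw ↦ ?_, fun hle ↦ hbH ?_⟩
  · rw [Subgraph.verts_sup, Set.mem_union, Walk.mem_verts_toSubgraph, Walk.support_cons,
      List.mem_cons] at hw ⊢
    rcases hw with hw | rfl | hw
    · exact .inl (hH hw)
    · exact .inl (hH huH)
    · exact (hmate w hw).imp_right .inr
  · exact hle.1 (by simp)

lemma EarBuilt.verts_nonempty (hH : EarBuilt A B H) : H.verts.Nonempty := by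
  cases hH with
  | base huv => exact ⟨_, .inl rfl⟩
  | addEar p _ hp => exact ⟨_, .inl hp.start_mem⟩

lemma IsBicoloring.isEar_edge (h : IsBicoloring G A B) (hH : H.IsSpanning) (hu : u ∈ A)
    (huv : G.Adj u v) : IsEar A B H huv.toWalk where
  isPath := by simpa using huv.ne
  even := by simp
  start_mem_class := hu
  end_mem_class := h.mem_right_of_adj hu huv
  start_mem := hH u
  end_mem := hH v
  inter w hw _ := by simpa using hw

lemma HasSurplus.eq_top_of_maximal [Finite V] (hA : HasSurplus G A) (h : IsBicoloring G A B)
    (hm : IsMate G m)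
    (hH : Maximal (fun H : G.Subgraph ↦ EarBuilt A B H ∧ Set.MapsTo m H.verts H.verts) H) :
    H = ⊤ := by
  obtain ⟨hbuilt, hmaps⟩ := hH.prop
  have hle {u v : V} (p : G.Walk u v) (hp : IsEar A B H p)
      (hpm : Set.MapsTo m (H ⊔ p.toSubgraph).verts (H ⊔ p.toSubgraph).verts) :
      p.toSubgraph ≤ H :=
    le_sup_right.trans (hH.le_of_ge ⟨hbuilt.addEar p hp, hpm⟩ le_sup_left)
  obtain ⟨a, ha, haH⟩ : ∃ a ∈ A, a ∈ H.verts := by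
    obtain ⟨x, hx⟩ := hbuilt.verts_nonempty
    rcases h.mem_or_mem x with hxA | hxB
    · exact ⟨x, hxA, hx⟩
    · exact ⟨m x, h.mem_left_of_adj hxB (hm.adj x), hmaps hx⟩
  have hAH : ∀ z ∈ A, z ∈ H.verts := by
    by_contra! hspan
    obtain ⟨u, v, p, hp, hpm, hpH⟩ := hA.exists_isEar h hm hmaps ha haH hspan
    exact hpH (hle p hp hpm)
  have hspan : H.IsSpanning := fun z ↦ (h.mem_or_mem z).elim (hAH z) fun hzB ↦
    hm.involutive z ▸ hmaps (hAH (m z) (h.mem_left_of_adj hzB (hm.adj z)))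
  have hadj : ∀ u ∈ A, ∀ v, G.Adj u v → H.Adj u v := fun u hu v huv ↦
    (hle _ (h.isEar_edge hspan hu huv) fun w _ ↦ .inl (hspan (m w))).2 (by simp)
  refine top_unique ⟨fun v _ ↦ hspan v, fun u v (huv : G.Adj u v) ↦ ?_⟩
  rcases h.mem_or_mem u with hu | hu
  · exact hadj u hu v huv
  · exact (hadj v (h.mem_left_of_adj hu huv) u huv.symm).symm

lemma HasSurplus.hasEarDecomposition [Finite V] [Nonempty V] (hA : HasSurplus G A)
    (h : IsBicoloring G A B) (hm : IsMate G m) : HasEarDecomposition G A B := by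
  let a := Classical.arbitrary V
  have hmaps : Set.MapsTo m (G.subgraphOfAdj (hm.adj a)).verts
      (G.subgraphOfAdj (hm.adj a)).verts := by
    rintro _ (rfl | rfl)
    · exact .inr rfl
    · exact .inl (hm.involutive a)
  obtain ⟨H, hH⟩ := Set.Finite.exists_maximal
    (Set.toFinite {H : G.Subgraph | EarBuilt A B H ∧ Set.MapsTo m H.verts H.verts})
    ⟨G.subgraphOfAdj (hm.adj a), .base _, hmaps⟩
  rw [HasEarDecomposition, ← hA.eq_top_of_maximal h hm hH]
  exact hH.prop.1

end Sufficiency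

end BistableGraph

theorem theorem4p3 {V : Type*} [Fintype V] [DecidableEq V] (G : SimpleGraph V) (A B : Finset V)
    (hG : BistableGraph.IsBipartition G A B) (hV : 4 ≤ Fintype.card V) :
    List.TFAE [
      BistableGraph.IsCoverIrreducible G A B,
      BistableGraph.IsBistable G A B,
      BistableGraph.HasSurplus G A ∧ BistableGraph.HasSurplus G B,
      A.card = B.card ∧ BistableGraph.HasSurplus G A,
      ∀ a ∈ A, ∀ b ∈ B, BistableGraph.IsAlphaPlusStable (BistableGraph.deletePair G a b),
      ∀ a ∈ A, ∀ b ∈ B, BistableGraph.HasPerfectMatching (BistableGraph.deletePair G a b),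
      G.Connected ∧ BistableGraph.EveryEdgeMatched G,
      BistableGraph.IsElementary G,
      BistableGraph.HasEarDecomposition G A B] := by
  have h := hG.isBicoloring
  have hA := hG.left_nonempty
  have hB := hG.right_nonempty
  have hAB : 4 ≤ A.card + B.card := by
    simpa using hV.trans (h.card_inter_add_card_inter Finset.univ).ge
  have : Nontrivial V := Fintype.one_lt_card_iff_nontrivial.1 (by lia)
  tfae_have 1 ↔ 2 := h.isCoverIrreducible_iff
  tfae_have 2 → 3 := fun h2 ↦ ⟨h2.hasSurplus h, h2.symm.hasSurplus h.symm⟩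
  tfae_have 3 → 4 := fun ⟨hsA, hsB⟩ ↦
    ⟨(hsA.card_le_card h (by lia)).antisymm (hsB.card_le_card h.symm (by lia)), hsA⟩
  tfae_have 4 → 2 := fun ⟨heq, hsA⟩ ↦ hsA.isBistable h heq (by lia)
  tfae_have 5 ↔ 6 := h.forall_isAlphaPlusStable_deletePair_iff hAB hA hB
  tfae_have 6 ↔ 4 := h.forall_hasPerfectMatching_deletePair_iff hA hB
  tfae_have 4 → 7 := fun ⟨heq, hsA⟩ ↦
    let ⟨_, hm⟩ := hsA.exists_isMate h heq (by lia)
    ⟨hsA.connected h hm hA, h.everyEdgeMatched (tfae_6_iff_4.2 ⟨heq, hsA⟩)⟩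
  tfae_have 7 → 8 := fun ⟨hc, hmatched⟩ ↦ hmatched.isElementary hc
  tfae_have 8 → 4 := fun h8 ↦ ⟨h8.card_eq h, h8.hasSurplus h⟩
  tfae_have 4 → 9 := fun ⟨heq, hsA⟩ ↦
    let ⟨_, hm⟩ := hsA.exists_isMate h heq (by lia)
    hsA.hasEarDecomposition h hm
  tfae_have 9 → 2 := fun h9 ↦ h9.isBistable h
  tfae_finish
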